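/- Let $n\in\mathbb{N}$, let $\mathrm{Sym}_n$ be the space of real symmetric $n\times n$ matrices and $\mathrm{Sym}_n^+\subset\mathrm{Sym}_n$ the set of positive definite ones. For $\Sigma\in\mathrm{Sym}_n^+$ let $\phi_\Sigma\in\mathcal{S}(\mathbb{R}^n)$ be the density of $N(0,\Sigma)$, $$\phi_\Sigma(x)=\left[(2\pi)^n\det\Sigma\right]^{-1/2}e^{-\frac12\langle x,\Sigma^{-1}x\rangle},\qquad x\in\mathbb{R}^n .$$ Let $I=\{(i,j): 1\le i\le j\le n\}$, and let $\Omega:\mathbb{R}^I\to\mathrm{Sym}_n$ be the linear isomorphism that sends $A=(A_{i,j})_{i\le j}$ to the symmetric matrix with entries $\Omega(A)_{i,j}=\Omega(A)_{j,i}=A_{i,j}$ for $i\le j$. For $\beta\in\mathbb{N}_0^I$ put $$|\beta|_{\shortparallel}=\sum_{i=1}^n\beta(i,i),\qquad \beta_\flat=\sum_{(i,j)\in I}\beta(i,j)\,(e_i+e_j)\in\mathbb{N}_0^n,$$ where $e_1,\dots,e_n$ is the standard basis of $\mathbb{R}^n$. **Theorem (Generalized Price Theorem).** Let $g\in\mathcal{S}'(\mathbb{R}^n)$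 be an arbitrary (complex-valued) tempered distribution, and let $\Phi_g:\mathrm{Sym}_n^+\to\mathbb{C}$, $\Phi_g(\Sigma)=\langle g,\phi_\Sigma\rangle_{\mathcal{S}',\mathcal{S}}$. Then $U=\Omega^{-1}(\mathrm{Sym}_n^+)\subset\mathbb{R}^I$ is open, the function $\Phi_g\circ\Omega$ is smooth on $U$, and $$\partial^\beta(\Phi_g\circ\Omega)(A)=\left(\tfrac12\right)^{|\beta|_{\shortparallel}}\left\langle \partial^{\beta_\flat}g,\ \phi_{\Omega(A)}\right\rangle_{\mathcal{S}',\mathcal{S}}\qquad\text{for all }A\in U\text{ and all }\beta\in\mathbb{N}_0^I,$$ where $\partial^{\beta_\flat}g$ is the distributional derivative of $g$. -/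

import Mathlib

open scoped SchwartzMap ContDiff LineDeriv Matrix

noncomputable section

namespace Price

/-! ### Index set, coordinates on symmetric matrices, multi-indices -/

/-- The index set `I = {(i, j) : i ≤ j}`. -/
abbrev Idx (n : ℕ) : Type := {p : Fin n × Fin n // p.1 ≤ p.2}

/-- The parametrization `Ω : ℝ^I → Sym_n`: the symmetric matrix whose entries on and above the
diagonal are prescribed. -/
def symMatrix {n : ℕ} (A : Idx n → ℝ) : Matrix (Fin n) (Fin n) ℝ :=
  Matrix.of fun i j => if h : i ≤ j then A ⟨(i, j), h⟩ else A ⟨(j, i), le_of_not_ge h⟩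

/-- `U = Ω⁻¹(Sym_n⁺)`, the set of coordinates of (symmetric) positive definite matrices. -/
def posDefCoords (n : ℕ) : Set (Idx n → ℝ) := {A | (symMatrix A).PosDef}

/-- The flattened multi-index `β♭ = ∑_{(i,j) ∈ I} β(i,j) (e_i + e_j) ∈ ℕ^n`. -/
def flatten {n : ℕ} (β : Idx n → ℕ) : Fin n → ℕ :=
  ∑ p : Idx n, β p • (Pi.single p.1.1 1 + Pi.single p.1.2 1)

/-- `|β|_∥ = ∑_i β(i,i)`. -/
def diagDegree {n : ℕ} (β : Idx n → ℕ) : ℕ :=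
  ∑ i : Fin n, β ⟨(i, i), le_refl i⟩

/-- `∏_i (D i)^{β i}`, a composition of powers of operators indexed by a finite type. The factors
are composed in some fixed order; it is only used for partial derivatives of smooth functions
and of distributions, where the order is immaterial. -/
def multiOp {ι X : Type*} [Fintype ι] (D : ι → X → X) (β : ι → ℕ) : X → X :=
  (Finset.univ : Finset ι).toList.foldr (fun i T => (D i)^[β i] ∘ T) id

/-- The iterated classical partial derivative `∂^β F` of a function `F : ℝ^ι → ℂ`. -/
def partialDeriv {ι : Type*} [Fintype ι] [DecidableEq ι] (β : ι → ℕ) (F : (ι → ℝ) → ℂ) :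
    (ι → ℝ) → ℂ :=
  multiOp (fun i (G : (ι → ℝ) → ℂ) x => lineDeriv ℝ G x (Pi.single i 1)) β F

/-- The distributional derivative `∂^α g` of a tempered distribution on `ℝ^n`. -/
def distribDeriv {n : ℕ} (α : Fin n → ℕ) (g : 𝓢'(EuclideanSpace ℝ (Fin n), ℂ)) :
    𝓢'(EuclideanSpace ℝ (Fin n), ℂ) :=
  multiOp (fun i (T : 𝓢'(EuclideanSpace ℝ (Fin n), ℂ)) =>
    ∂_{EuclideanSpace.single i (1 : ℝ)} T) α g

/-! ### The Gaussian density as a Schwartz function -/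

/-- The exponent `-(1/2) ⟨x, S⁻¹ x⟩`. -/
def gaussianExponent {n : ℕ} (S : Matrix (Fin n) (Fin n) ℝ) (x : EuclideanSpace ℝ (Fin n)) : ℝ :=
  -(1 / 2) * (x.ofLp ⬝ᵥ S⁻¹ *ᵥ x.ofLp)

/-- The density `φ_S(x) = ((2π)^n det S)^(-1/2) exp(-(1/2) ⟨x, S⁻¹ x⟩)` of `N(0, S)`. -/
def gaussianDensity {n : ℕ} (S : Matrix (Fin n) (Fin n) ℝ) (x : EuclideanSpace ℝ (Fin n)) : ℝ :=
  ((2 * Real.pi) ^ n * S.det) ^ (-(1 / 2) : ℝ) * Real.exp (gaussianExponent S x)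

theorem hasTemperateGrowth_gaussianExponent {n : ℕ} (S : Matrix (Fin n) (Fin n) ℝ) :
    (gaussianExponent S).HasTemperateGrowth := by
  have hc (i : Fin n) : (fun x : EuclideanSpace ℝ (Fin n) => x.ofLp i).HasTemperateGrowth :=
    (EuclideanSpace.proj (𝕜 := ℝ) i).hasTemperateGrowth
  have : gaussianExponent S = fun x : EuclideanSpace ℝ (Fin n) =>
      -(1 / 2) * ∑ i, x.ofLp i * ∑ j, S⁻¹ i j * x.ofLp j := by
    ext x; simp [gaussianExponent, dotProduct, Matrix.mulVec]
  rw [this]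
  refine (Function.HasTemperateGrowth.const _).mul (.sum fun i _ => (hc i).mul
    (.sum fun j _ => (Function.HasTemperateGrowth.const _).mul (hc j)))

theorem gaussianExponent_le {n : ℕ} {S : Matrix (Fin n) (Fin n) ℝ} (hS : S.PosDef) :
    ∃ b : ℝ, 0 < b ∧ ∀ x, gaussianExponent S x ≤ -(b * ‖x‖ ^ 2) := by
  have hcont : Continuous (gaussianExponent S) :=
    (hasTemperateGrowth_gaussianExponent S).1.continuous
  have hneg (x : EuclideanSpace ℝ (Fin n)) (hx : x ≠ 0) : gaussianExponent S x < 0 := by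
    have h0 : x.ofLp ≠ 0 := fun h => hx (by ext i; simp [h])
    have := hS.inv.dotProduct_mulVec_pos h0
    simp only [star_trivial] at this
    unfold gaussianExponent
    linarith
  have hhom (c : ℝ) (x : EuclideanSpace ℝ (Fin n)) :
      gaussianExponent S (c • x) = c ^ 2 * gaussianExponent S x := by
    simp only [gaussianExponent, WithLp.ofLp_smul, Matrix.mulVec_smul, dotProduct_smul,
      smul_dotProduct, smul_eq_mul]
    ring
  rcases (Metric.sphere (0 : EuclideanSpace ℝ (Fin n)) 1).eq_empty_or_nonempty with he | hne
  · refine ⟨1, one_pos, fun x => ?_⟩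
    have hx : x = 0 := by
      by_contra hx
      have : (‖x‖⁻¹ • x) ∈ Metric.sphere (0 : EuclideanSpace ℝ (Fin n)) 1 := by
        simp [norm_smul, hx]
      simp [he] at this
    simp [hx, gaussianExponent]
  · obtain ⟨y, hy, hmax⟩ := (isCompact_sphere (0 : EuclideanSpace ℝ (Fin n)) 1).exists_isMaxOn
      hne hcont.continuousOn
    have hy0 : y ≠ 0 := by
      rintro rfl
      simp at hy
    refine ⟨-gaussianExponent S y, by linarith [hneg y hy0], fun x => ?_⟩
    by_cases hx : x = 0
    · simp [hx, gaussianExponent]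
    have hmem : (‖x‖⁻¹ • x) ∈ Metric.sphere (0 : EuclideanSpace ℝ (Fin n)) 1 := by
      simp [norm_smul, hx]
    have h1 : gaussianExponent S (‖x‖⁻¹ • x) ≤ gaussianExponent S y := hmax hmem
    have hxx : x = ‖x‖ • (‖x‖⁻¹ • x) := by
      rw [smul_smul, mul_inv_cancel₀ (norm_ne_zero_iff.mpr hx), one_smul]
    have h2 : gaussianExponent S x = ‖x‖ ^ 2 * gaussianExponent S (‖x‖⁻¹ • x) := by
      rw [← hhom, ← hxx]
    nlinarith [sq_nonneg ‖x‖]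

theorem pow_mul_exp_neg_sq_le {b : ℝ} (hb : 0 < b) (N : ℕ) :
    ∃ C : ℝ, ∀ r : ℝ, 0 ≤ r → (1 + r) ^ N * Real.exp (-(b * r ^ 2)) ≤ C := by
  refine ⟨2 ^ N * (N.factorial / b ^ N * Real.exp b), fun r hr => ?_⟩
  have h1 : (1 + r) ^ N ≤ (2 * (1 + r ^ 2)) ^ N :=
    pow_le_pow_left₀ (by positivity) (by nlinarith [sq_nonneg (1 - r)]) N
  have h2 : (b * (1 + r ^ 2)) ^ N / N.factorial ≤ Real.exp (b * (1 + r ^ 2)) :=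
    Real.pow_div_factorial_le_exp _ (by positivity) N
  have h3 : (1 + r ^ 2) ^ N ≤ N.factorial / b ^ N * Real.exp (b * (1 + r ^ 2)) := by
    rw [mul_pow, div_le_iff₀ (by positivity)] at h2
    rw [div_mul_eq_mul_div, le_div_iff₀ (by positivity)]
    linarith
  have h4 : Real.exp (b * (1 + r ^ 2)) * Real.exp (-(b * r ^ 2)) = Real.exp b := by
    rw [← Real.exp_add]; ring_nf
  calc (1 + r) ^ N * Real.exp (-(b * r ^ 2))
      ≤ (2 ^ N * (N.factorial / b ^ N * Real.exp (b * (1 + r ^ 2)))) *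
          Real.exp (-(b * r ^ 2)) := by
        gcongr
        refine h1.trans ?_
        rw [mul_pow]
        gcongr
    _ = _ := by rw [← h4]; ring

theorem contDiff_gaussianDensity {n : ℕ} (S : Matrix (Fin n) (Fin n) ℝ) :
    ContDiff ℝ ∞ (gaussianDensity S) :=
  contDiff_const.mul (hasTemperateGrowth_gaussianExponent S).1.exp

theorem decay_gaussianDensity {n : ℕ} {S : Matrix (Fin n) (Fin n) ℝ} (hS : S.PosDef) (k m : ℕ) :
    ∃ C : ℝ, ∀ x, ‖x‖ ^ k * ‖iteratedFDeriv ℝ m (gaussianDensity S) x‖ ≤ C := by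
  obtain ⟨b, hb, hq⟩ := gaussianExponent_le hS
  obtain ⟨l, D, hD, hbound⟩ :=
    (hasTemperateGrowth_gaussianExponent S).norm_iteratedFDeriv_le_uniform m
  obtain ⟨C, hC⟩ := pow_mul_exp_neg_sq_le hb (k + l * m)
  set c : ℝ := ((2 * Real.pi) ^ n * S.det) ^ (-(1 / 2) : ℝ) with hc
  refine ⟨|c| * (m.factorial * (1 + D) ^ m * C), fun x => ?_⟩
  have hcomp : gaussianDensity S = c • (Real.exp ∘ gaussianExponent S) := by
    ext y; simp [gaussianDensity, hc]
  have hsm : ContDiff ℝ ∞ (Real.exp ∘ gaussianExponent S) :=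
    (hasTemperateGrowth_gaussianExponent S).1.exp
  have key : ‖iteratedFDeriv ℝ m (Real.exp ∘ gaussianExponent S) x‖ ≤
      m.factorial * Real.exp (gaussianExponent S x) * ((1 + D) * (1 + ‖x‖) ^ l) ^ m := by
    refine norm_iteratedFDeriv_comp_le (N := ∞) Real.contDiff_exp
      (hasTemperateGrowth_gaussianExponent S).1 (by exact_mod_cast le_top) x ?_ ?_
    · intro i _
      rw [norm_iteratedFDeriv_eq_norm_iteratedDeriv, iteratedDeriv_eq_iterate,
        Real.iter_deriv_exp, Real.norm_of_nonneg (Real.exp_pos _).le]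
    · intro i h1 hi
      have hone : 1 ≤ (1 + D) * (1 + ‖x‖) ^ l :=
        one_le_mul_of_one_le_of_one_le (by linarith)
          (one_le_pow₀ (by linarith [norm_nonneg x]))
      refine (hbound i hi x).trans (le_trans ?_ (le_self_pow₀ hone (by omega)))
      gcongr
      linarith
  have hexp : Real.exp (gaussianExponent S x) ≤ Real.exp (-(b * ‖x‖ ^ 2)) :=
    Real.exp_le_exp.mpr (hq x)
  have hxk : ‖x‖ ^ k ≤ (1 + ‖x‖) ^ k := by gcongr; linarith
  rw [hcomp, iteratedFDeriv_const_smul_apply (hsm.contDiffAt.of_le (by exact_mod_cast le_top)),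
    norm_smul, Real.norm_eq_abs]
  calc ‖x‖ ^ k * (|c| * ‖iteratedFDeriv ℝ m (Real.exp ∘ gaussianExponent S) x‖)
      ≤ (1 + ‖x‖) ^ k * (|c| * (m.factorial * Real.exp (-(b * ‖x‖ ^ 2)) *
          ((1 + D) * (1 + ‖x‖) ^ l) ^ m)) := by
        gcongr
        refine key.trans ?_
        gcongr
    _ = |c| * (m.factorial * (1 + D) ^ m *
          ((1 + ‖x‖) ^ (k + l * m) * Real.exp (-(b * ‖x‖ ^ 2)))) := by
        rw [mul_pow, ← pow_mul, pow_add]; ring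
    _ ≤ _ := by
        gcongr
        exact hC _ (norm_nonneg x)

/-- The density `φ_S` of `N(0, S)`, for `S` positive definite, as an element of `𝓢(ℝ^n)`. -/
def gaussianSchwartz {n : ℕ} (S : Matrix (Fin n) (Fin n) ℝ) (hS : S.PosDef) :
    𝓢(EuclideanSpace ℝ (Fin n), ℂ) where
  toFun x := (gaussianDensity S x : ℂ)
  smooth' := Complex.ofRealCLM.contDiff.comp (contDiff_gaussianDensity S)
  decay' k m := by
    obtain ⟨C, hC⟩ := decay_gaussianDensity hS k m
    refine ⟨C, fun x => ?_⟩
    have h := Complex.ofRealLI.norm_iteratedFDeriv_comp_left (f := gaussianDensity S) (x := x)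
      (contDiff_gaussianDensity S).contDiffAt (i := m) (by exact_mod_cast le_top)
    have h' : (⇑Complex.ofRealLI ∘ gaussianDensity S) = fun y => (gaussianDensity S y : ℂ) := rfl
    rw [h'] at h
    rw [h]
    exact hC x

open Classical in
/-- The function `Φ_g : Sym_n⁺ → ℂ`, `S ↦ ⟨g, φ_S⟩`, extended by `0` to all other matrices. -/
def gaussianPairing {n : ℕ} (g : 𝓢'(EuclideanSpace ℝ (Fin n), ℂ))
    (S : Matrix (Fin n) (Fin n) ℝ) : ℂ :=
  if hS : S.PosDef then g (gaussianSchwartz S hS) else 0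

end Price

end

noncomputable section

namespace Price

/-! ### Iterated derivatives: commutation, restriction to slices, first order Taylor estimate -/

section Calculus

variable {W F : Type*} [NormedAddCommGroup W] [NormedSpace ℝ W] [NormedAddCommGroup F]
  [NormedSpace ℝ F]

/-! The Gaussian density satisfies a heat equation in its covariance: moving `S` along the
coordinate `(i, j)` changes `φ_S` at the rate `∂_i ∂_j φ_S`, halved if `i = j`. Pairing with `g` and
moving both derivatives onto `g` gives `∂_p Φ_g = diagFactor p * Φ_h` with `h = ∂_i ∂_j g`. The
right side is of the same kind as `Φ_g`, so induction over all `g` at once yields smoothness and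
every higher derivative.

The analytic point is differentiation under the pairing. With `P = S⁻¹`, write `φ_S` as a scalar
times `exp (-(1/2) ⟪x, P x⟫)`. By `seminorm_expQuad_taylor_le` the first order Taylor remainder in
`P` is quadratically small in every Schwartz seminorm, so every continuous functional on Schwartz
space may be applied (`hasFDerivAt_pairing_expQuad`). The chain rule for inversion and Jacobi's
formula for the determinant give the derivative in `S` (`hasFDerivAt_gaussianPairing`); the heat
equation is then a pointwise identity (`gaussian_parameter_deriv_eq`). Commutation of derivatives
collects the pairs `e_i + e_j` into `flatten β`. -/

theorem iteratedFDeriv_fderiv_apply [CompleteSpace F] {f : W → F} (hf : ContDiff ℝ ω f) (m : ℕ)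
    (v z : W) :
    iteratedFDeriv ℝ m (fun y => fderiv ℝ f y v) z = fderiv ℝ (iteratedFDeriv ℝ m f) z v := by
  have hf' : ContDiff ℝ ω (fderiv ℝ f) := hf.fderiv_right (by simp)
  have h := (ContinuousLinearMap.apply ℝ F v).iteratedFDeriv_comp_left (f := fderiv ℝ f) (x := z)
    (i := m) hf'.contDiffAt le_top
  have h' : (⇑(ContinuousLinearMap.apply ℝ F v) ∘ fderiv ℝ f) = fun y => fderiv ℝ f y v := rfl
  rw [h'] at h
  ext w
  rw [h]
  have e1 : iteratedFDeriv ℝ (m + 1) f z (Fin.snoc w v) =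
      iteratedFDeriv ℝ m (fderiv ℝ f) z w v := by
    rw [iteratedFDeriv_succ_apply_right]; simp
  have e2 : iteratedFDeriv ℝ (m + 1) f z (Fin.cons v w) =
      fderiv ℝ (iteratedFDeriv ℝ m f) z v w := by
    rw [iteratedFDeriv_succ_apply_left]; simp
  -- Moving `v` from the last slot to the first is a cyclic permutation, harmless by symmetry of the
  -- iterated derivative.
  have e3 : iteratedFDeriv ℝ (m + 1) f z (Fin.snoc w v) =
      iteratedFDeriv ℝ (m + 1) f z (Fin.cons v w) := by
    have := hf.contDiffAt.iteratedFDeriv_comp_perm (x := z) (Fin.cons v w : Fin (m + 1) → W)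
      (finRotate (m + 1))
    rw [← this]
    congr 1
    ext i
    refine Fin.lastCases ?_ (fun j => ?_) i
    · simp
    · simp [Fin.coeSucc_eq_succ]
  exact e1.symm.trans (e3.trans e2)

/-- The slice is a translate of `f` composed with the inclusion `inr`, of norm at most 1. Estimates
can thus be made jointly in `(P, x)` and then restricted to derivatives in `x`. -/
theorem norm_iteratedFDeriv_slice_le {V E : Type*} [NormedAddCommGroup V] [NormedSpace ℝ V]
    [NormedAddCommGroup E] [NormedSpace ℝ E] {f : V × E → F} {m : ℕ} (hf : ContDiff ℝ m f)
    (p : V) (x : E) :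
    ‖iteratedFDeriv ℝ m (fun y => f (p, y)) x‖ ≤ ‖iteratedFDeriv ℝ m f (p, x)‖ := by
  have h1 : (fun y => f (p, y)) =
      (fun z => f (z + (p, 0))) ∘ ContinuousLinearMap.inr ℝ V E := by
    ext y; simp
  have h2 : ContDiff ℝ m (fun z : V × E => f (z + (p, 0))) :=
    hf.comp (contDiff_id.add contDiff_const)
  rw [h1, (ContinuousLinearMap.inr ℝ V E).iteratedFDeriv_comp_right h2 x le_rfl,
    iteratedFDeriv_comp_add_right]
  refine (ContinuousMultilinearMap.norm_compContinuousLinearMap_le _ _).trans ?_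
  have h3 : ‖ContinuousLinearMap.inr ℝ V E‖ ≤ 1 := by
    refine ContinuousLinearMap.opNorm_le_bound _ zero_le_one fun y => ?_
    simp
  have h4 : (ContinuousLinearMap.inr ℝ V E) x + (p, 0) = (p, x) := by simp
  rw [h4]
  refine mul_le_of_le_one_right (norm_nonneg _) ?_
  exact Finset.prod_le_one (fun _ _ => norm_nonneg _) (fun _ _ => h3)

theorem norm_sub_le_of_mem_segment {f : W → F} (hf : ContDiff ℝ 1 f) {z v : W} {C : ℝ}
    (hC : ∀ y ∈ segment ℝ z (z + v), ‖fderiv ℝ f y‖ ≤ C) {y : W} (hy : y ∈ segment ℝ z (z + v)) :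
    ‖f y - f z‖ ≤ C * ‖v‖ := by
  have hz : z ∈ segment ℝ z (z + v) := left_mem_segment ℝ _ _
  have hC0 : 0 ≤ C := (norm_nonneg (fderiv ℝ f z)).trans (hC z hz)
  have h1 := (convex_segment z (z + v)).norm_image_sub_le_of_norm_fderiv_le
    (fun y _ => (hf.differentiable one_ne_zero) y) hC hz hy
  refine h1.trans (mul_le_mul_of_nonneg_left ?_ hC0)
  obtain ⟨t, ht, rfl⟩ := (segment_eq_image' ℝ z (z + v) ▸ hy :
    y ∈ (fun θ : ℝ => z + θ • (z + v - z)) '' Set.Icc 0 1)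
  simp only [add_sub_cancel_left, norm_smul, Real.norm_eq_abs, abs_of_nonneg ht.1]
  exact mul_le_of_le_one_left (norm_nonneg _) ht.2

theorem norm_sub_sub_fderiv_le {f : W → F} (hf : Differentiable ℝ f) {z v : W} {C : ℝ}
    (hC : ∀ y ∈ segment ℝ z (z + v), ‖fderiv ℝ f y - fderiv ℝ f z‖ ≤ C) :
    ‖f (z + v) - f z - fderiv ℝ f z v‖ ≤ C * ‖v‖ := by
  have := (convex_segment z (z + v)).norm_image_sub_le_of_norm_hasFDerivWithin_le'
    (f := f) (f' := fderiv ℝ f) (φ := fderiv ℝ f z) (C := C)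
    (fun y _ => (hf y).hasFDerivAt.hasFDerivWithinAt) hC
    (left_mem_segment ℝ _ _) (right_mem_segment ℝ _ _)
  simpa [add_sub_cancel_left] using this

theorem norm_isometry_sub {G : Type*} [NormedAddCommGroup G] [NormedSpace ℝ G]
    (e : F ≃ₗᵢ[ℝ] G) (a b : F) : ‖e a - e b‖ = ‖a - b‖ := by
  rw [← map_sub, LinearIsometryEquiv.norm_map]

/-- The derivatives of the first order Taylor remainder in a fixed direction. -/
theorem norm_iteratedFDeriv_taylor_le [CompleteSpace F] {f : W → F} (hf : ContDiff ℝ ω f) (m : ℕ)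
    {z v : W} {C : ℝ}
    (hC : ∀ y ∈ segment ℝ z (z + v), ‖iteratedFDeriv ℝ (m + 2) f y‖ ≤ C) :
    ‖iteratedFDeriv ℝ m (fun y => f (y + v) - f y - fderiv ℝ f y v) z‖ ≤ C * ‖v‖ ^ 2 := by
  have hfm : ContDiff ℝ m f := hf.of_le le_top
  have h1 : ContDiff ℝ m (fun y => f (y + v)) := hfm.comp (contDiff_id.add contDiff_const)
  have h2 : ContDiff ℝ m (fun y => fderiv ℝ f y v) :=
    (hf.fderiv_right (m := ω) (by simp)).clm_apply contDiff_const |>.of_le le_top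
  have e1 : iteratedFDeriv ℝ m (fun y => f (y + v) - f y - fderiv ℝ f y v) z =
      iteratedFDeriv ℝ m f (z + v) - iteratedFDeriv ℝ m f z -
        fderiv ℝ (iteratedFDeriv ℝ m f) z v := by
    rw [fun_iteratedFDeriv_sub_apply (h1.sub hfm).contDiffAt h2.contDiffAt,
      fun_iteratedFDeriv_sub_apply h1.contDiffAt hfm.contDiffAt, iteratedFDeriv_comp_add_right,
      iteratedFDeriv_fderiv_apply hf]
  rw [e1]
  rw [pow_two, ← mul_assoc]
  refine norm_sub_sub_fderiv_le (hf.differentiable_iteratedFDeriv (by simp)) fun y hy => ?_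
  -- Up to the currying isometry this is the derivative of order `m + 1`; a second mean value
  -- estimate supplies the other factor `‖v‖`.
  rw [fderiv_iteratedFDeriv, Function.comp_apply, Function.comp_apply]
  refine (norm_isometry_sub _ _ _).trans_le ?_
  refine norm_sub_le_of_mem_segment (hf.iteratedFDeriv_right (m := 1) (i := m + 1) (by simp)) ?_ hy
  intro y hy
  rw [norm_fderiv_iteratedFDeriv]
  exact hC y hy

end Calculus

/-! ### Unnormalized Gaussians as a differentiable family of Schwartz functions -/

section QuadraticFamily

variable {E : Type*} [NormedAddCommGroup E] [InnerProductSpace ℝ E]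

/-- The exponent `-(1/2) ⟪x, P x⟫` as a function of the pair `(P, x)`. -/
def quadExponent (z : (E →L[ℝ] E) × E) : ℝ := -(1 / 2) * inner ℝ z.2 (z.1 z.2)

/-- The function `exp (-(1/2) ⟪x, P x⟫)` of the pair `(P, x)`. -/
def expQuadExponent (z : (E →L[ℝ] E) × E) : ℝ := Real.exp (quadExponent z)

variable (E) in
/-- The operators whose quadratic form is coercive. -/
def coerciveOps : Set (E →L[ℝ] E) := {P | ∃ b : ℝ, 0 < b ∧ ∀ x, b * ‖x‖ ^ 2 ≤ inner ℝ x (P x)}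

theorem hasTemperateGrowth_quadExponent :
    (quadExponent : (E →L[ℝ] E) × E → ℝ).HasTemperateGrowth := by
  have h1 : (fun z : (E →L[ℝ] E) × E => z.1).HasTemperateGrowth :=
    (ContinuousLinearMap.fst ℝ (E →L[ℝ] E) E).hasTemperateGrowth
  have h2 : (fun z : (E →L[ℝ] E) × E => z.2).HasTemperateGrowth :=
    (ContinuousLinearMap.snd ℝ (E →L[ℝ] E) E).hasTemperateGrowth
  have h3 : (fun z : (E →L[ℝ] E) × E => z.1 z.2).HasTemperateGrowth :=
    (ContinuousLinearMap.id ℝ (E →L[ℝ] E)).bilinear_hasTemperateGrowth h1 h2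
  exact (Function.HasTemperateGrowth.const _).mul
    ((innerSL ℝ).bilinear_hasTemperateGrowth h2 h3)

theorem hasTemperateGrowth_quadExponent_slice (P : E →L[ℝ] E) :
    (fun x => quadExponent (P, x)).HasTemperateGrowth :=
  (Function.HasTemperateGrowth.const _).mul
    ((innerSL ℝ).bilinear_hasTemperateGrowth Function.HasTemperateGrowth.id' P.hasTemperateGrowth)

theorem contDiff_quadExponent {k : WithTop ℕ∞} :
    ContDiff ℝ k (quadExponent : (E →L[ℝ] E) × E → ℝ) :=
  contDiff_const.mul (contDiff_snd.inner ℝ (contDiff_fst.clm_apply contDiff_snd))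

theorem contDiff_expQuadExponent {k : WithTop ℕ∞} :
    ContDiff ℝ k (expQuadExponent : (E →L[ℝ] E) × E → ℝ) :=
  Real.contDiff_exp.comp contDiff_quadExponent

/-- The exponent is linear in `P`, hence affine along the line `(P, x) + s • (K, 0)`. -/
theorem fderiv_expQuadExponent_inl (P K : E →L[ℝ] E) (x : E) :
    fderiv ℝ expQuadExponent (P, x) (K, 0) =
      quadExponent (K, x) * Real.exp (quadExponent (P, x)) := by
  have h1 : HasFDerivAt expQuadExponent (fderiv ℝ expQuadExponent (P, x)) (P, x) :=
    (contDiff_expQuadExponent.differentiable one_ne_zero _).hasFDerivAt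
  have h2 : HasDerivAt (fun s : ℝ => (P, x) + s • ((K, 0) : (E →L[ℝ] E) × E)) (K, 0) 0 := by
    simpa using ((hasDerivAt_id (0 : ℝ)).smul_const ((K, 0) : (E →L[ℝ] E) × E)).const_add (P, x)
  have h3 := HasFDerivAt.comp_hasDerivAt (x := (0 : ℝ)) (l := expQuadExponent)
    (f := fun s : ℝ => (P, x) + s • ((K, 0) : (E →L[ℝ] E) × E)) (by simpa using h1) h2
  have h4 : HasDerivAt (fun s : ℝ => Real.exp (quadExponent (P, x) + s * quadExponent (K, x)))
      (quadExponent (K, x) * Real.exp (quadExponent (P, x))) 0 := by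
    have := (((hasDerivAt_id (0 : ℝ)).mul_const (quadExponent (K, x))).const_add
      (quadExponent (P, x))).exp
    simpa [mul_comm] using this
  refine h3.unique (h4.congr_of_eventuallyEq (.of_forall fun s => ?_))
  simp only [Function.comp_apply, expQuadExponent, quadExponent, Prod.fst_add, Prod.snd_add,
    Prod.smul_fst, Prod.smul_snd, smul_zero, add_zero, add_apply,
    smul_apply, inner_add_right, inner_smul_right]
  congr 1
  ring

/-- Derivatives of the exponential are the exponential times factors of polynomial growth, and
coercivity makes the exponential Gaussian in `x`. The constant is uniform over bounded `P` with a
common `b`, as needed along a whole segment of operators. -/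
theorem decay_expQuadExponent {b : ℝ} (hb : 0 < b) (R : ℝ) (k m : ℕ) :
    ∃ C : ℝ, ∀ (P : E →L[ℝ] E) (x : E), ‖P‖ ≤ R → b * ‖x‖ ^ 2 ≤ inner ℝ x (P x) →
      ‖x‖ ^ k * ‖iteratedFDeriv ℝ m expQuadExponent (P, x)‖ ≤ C := by
  obtain ⟨l, D, hD, hbound⟩ :=
    (hasTemperateGrowth_quadExponent (E := E)).norm_iteratedFDeriv_le_uniform m
  obtain ⟨C, hC⟩ := pow_mul_exp_neg_sq_le (half_pos hb) (k + l * m)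
  refine ⟨m.factorial * ((1 + D) * (1 + R) ^ l) ^ m * C, fun P x hP hx => ?_⟩
  have hR : 0 ≤ R := (norm_nonneg P).trans hP
  have hz : 1 + ‖(P, x)‖ ≤ (1 + R) * (1 + ‖x‖) := by
    have : ‖(P, x)‖ ≤ R + ‖x‖ := by
      rw [Prod.norm_mk]
      exact max_le (by linarith [norm_nonneg x]) (by linarith)
    nlinarith [norm_nonneg x]
  have key : ‖iteratedFDeriv ℝ m expQuadExponent (P, x)‖ ≤
      m.factorial * Real.exp (quadExponent (P, x)) *
        ((1 + D) * ((1 + R) * (1 + ‖x‖)) ^ l) ^ m := by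
    refine norm_iteratedFDeriv_comp_le (N := ∞) (g := Real.exp) Real.contDiff_exp
      contDiff_quadExponent (by exact_mod_cast le_top) (P, x) ?_ ?_
    · intro i _
      rw [norm_iteratedFDeriv_eq_norm_iteratedDeriv, iteratedDeriv_eq_iterate,
        Real.iter_deriv_exp, Real.norm_of_nonneg (Real.exp_pos _).le]
    · intro i h1 hi
      -- The composition bound wants the `i`-th power of one base; using `1 + D` makes the base at
      -- least 1, so it is below its own powers.
      have hone : 1 ≤ (1 + D) * ((1 + R) * (1 + ‖x‖)) ^ l :=
        one_le_mul_of_one_le_of_one_le (by linarith)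
          (one_le_pow₀ (by nlinarith [norm_nonneg x]))
      refine (hbound i hi (P, x)).trans (le_trans ?_ (le_self_pow₀ hone (by omega)))
      gcongr
      linarith
  have hexp : Real.exp (quadExponent (P, x)) ≤ Real.exp (-(b / 2 * ‖x‖ ^ 2)) := by
    refine Real.exp_le_exp.mpr ?_
    simp only [quadExponent]
    linarith
  have hxk : ‖x‖ ^ k ≤ (1 + ‖x‖) ^ k := by gcongr; linarith
  calc ‖x‖ ^ k * ‖iteratedFDeriv ℝ m expQuadExponent (P, x)‖
      ≤ (1 + ‖x‖) ^ k * (m.factorial * Real.exp (-(b / 2 * ‖x‖ ^ 2)) *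
          ((1 + D) * ((1 + R) * (1 + ‖x‖)) ^ l) ^ m) := by
        gcongr
        refine key.trans ?_
        gcongr
    _ = m.factorial * ((1 + D) * (1 + R) ^ l) ^ m *
          ((1 + ‖x‖) ^ (k + l * m) * Real.exp (-(b / 2 * ‖x‖ ^ 2))) := by
        rw [mul_pow, mul_pow, mul_pow, mul_pow, ← pow_mul, ← pow_mul, pow_add]; ring
    _ ≤ _ := by
        gcongr
        exact hC _ (norm_nonneg x)

theorem inner_apply_perturb {P K : E →L[ℝ] E} {b : ℝ}
    (hP : ∀ x, b * ‖x‖ ^ 2 ≤ inner ℝ x (P x)) (hK : ‖K‖ ≤ b / 2) (x : E) :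
    b / 2 * ‖x‖ ^ 2 ≤ inner ℝ x ((P + K) x) := by
  have h1 : |inner ℝ x (K x)| ≤ b / 2 * ‖x‖ ^ 2 := by
    refine (abs_real_inner_le_norm _ _).trans ?_
    have := (K.le_opNorm x).trans (mul_le_mul_of_nonneg_right hK (norm_nonneg x))
    nlinarith [norm_nonneg x]
  rw [add_apply, inner_add_right]
  linarith [hP x, neg_abs_le (inner ℝ x (K x))]

theorem isOpen_coerciveOps : IsOpen (coerciveOps E) := by
  rw [Metric.isOpen_iff]
  rintro P ⟨b, hb, hP⟩
  refine ⟨b / 2, half_pos hb, fun P' hP' => ⟨b / 2, half_pos hb, fun x => ?_⟩⟩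
  have := inner_apply_perturb hP (K := P' - P) (by
    rw [← dist_eq_norm]; exact (Metric.mem_ball.mp hP').le) x
  simpa using this

/-- The Schwartz function `exp (-(1/2) ⟪x, P x⟫)`, for a coercive operator `P`. -/
def expQuad (P : E →L[ℝ] E) (hP : P ∈ coerciveOps E) : 𝓢(E, ℝ) where
  toFun x := expQuadExponent (P, x)
  smooth' := contDiff_expQuadExponent.comp (contDiff_const.prodMk contDiff_id)
  decay' k m := by
    obtain ⟨b, hb, hP⟩ := hP
    obtain ⟨C, hC⟩ := decay_expQuadExponent (E := E) hb ‖P‖ k m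
    refine ⟨C, fun x => le_trans ?_ (hC P x le_rfl (hP x))⟩
    gcongr
    exact norm_iteratedFDeriv_slice_le contDiff_expQuadExponent P x

theorem expQuad_apply (P : E →L[ℝ] E) (hP : P ∈ coerciveOps E) (x : E) :
    expQuad P hP x = Real.exp (quadExponent (P, x)) := rfl

open Classical in
/-- `expQuad` extended by `0` to all operators. -/
def expQuadTotal (P : E →L[ℝ] E) : 𝓢(E, ℝ) :=
  if hP : P ∈ coerciveOps E then expQuad P hP else 0

theorem expQuadTotal_of_mem {P : E →L[ℝ] E} (hP : P ∈ coerciveOps E) :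
    expQuadTotal P = expQuad P hP := dif_pos hP

/-- The derivative of `expQuad` at `P` in the direction `K`. -/
def expQuadDeriv (P K : E →L[ℝ] E) : 𝓢(E, ℝ) :=
  SchwartzMap.smulLeftCLM ℝ (fun x => quadExponent (K, x)) (expQuadTotal P)

theorem expQuadDeriv_apply {P : E →L[ℝ] E} (hP : P ∈ coerciveOps E) (K : E →L[ℝ] E) (x : E) :
    expQuadDeriv P K x = quadExponent (K, x) * Real.exp (quadExponent (P, x)) := by
  rw [expQuadDeriv, expQuadTotal_of_mem hP,
    SchwartzMap.smulLeftCLM_apply_apply (hasTemperateGrowth_quadExponent_slice K), expQuad_apply,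
    smul_eq_mul]

/-- The remainder is the slice at `P` of a joint Taylor remainder in direction `(K, 0)`. For `‖K‖ ≤
b / 2` the segment from `P` to `P + K` keeps coercivity constant `b / 2`, so the uniform decay of
order `m + 2` applies. The radius does not depend on `k` and `m`. -/
theorem seminorm_expQuad_taylor_le {P : E →L[ℝ] E} (hP : P ∈ coerciveOps E) :
    ∃ r : ℝ, 0 < r ∧ ∀ k m : ℕ, ∃ C : ℝ, ∀ K : E →L[ℝ] E, ‖K‖ ≤ r →
      SchwartzMap.seminorm ℝ k m (expQuadTotal (P + K) - expQuadTotal P - expQuadDeriv P K) ≤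
        C * ‖K‖ ^ 2 := by
  obtain ⟨b, hb, hPb⟩ := id hP
  refine ⟨b / 2, half_pos hb, fun k m => ?_⟩
  obtain ⟨C, hC⟩ := decay_expQuadExponent (E := E) (half_pos hb) (‖P‖ + b / 2) k (m + 2)
  refine ⟨C, fun K hK => ?_⟩
  have hC0 : 0 ≤ C := by
    refine le_trans ?_ (hC P 0 (by linarith) (by simp))
    positivity
  refine SchwartzMap.seminorm_le_bound ℝ k m _ (by positivity) fun x => ?_
  have hPK : P + K ∈ coerciveOps E := ⟨b / 2, half_pos hb, inner_apply_perturb hPb hK⟩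
  let S : (E →L[ℝ] E) × E → ℝ := fun z =>
    expQuadExponent (z + (K, 0)) - expQuadExponent z - fderiv ℝ expQuadExponent z (K, 0)
  have hS : ContDiff ℝ m S := by
    refine ((contDiff_expQuadExponent.comp (contDiff_id.add contDiff_const)).sub
      contDiff_expQuadExponent).sub ?_
    exact ((contDiff_expQuadExponent (k := m + 1)).fderiv_right (m := m) le_rfl).clm_apply
      contDiff_const
  have hfun : ⇑(expQuadTotal (P + K) - expQuadTotal P - expQuadDeriv P K) =
      fun y => S (P, y) := by
    ext y
    simp only [sub_apply, expQuadTotal_of_mem hPK, expQuadTotal_of_mem hP,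
      expQuadDeriv_apply hP, expQuad_apply, S, fderiv_expQuadExponent_inl, expQuadExponent,
      Prod.mk_add_mk, add_zero]
  rw [hfun]
  -- The point `x` is constant along the segment, so the weight can be divided out unless it
  -- vanishes.
  by_cases hx : ‖x‖ ^ k = 0
  · rw [hx, zero_mul]; positivity
  have hxk : 0 < ‖x‖ ^ k := lt_of_le_of_ne (by positivity) (Ne.symm hx)
  have hT : ‖iteratedFDeriv ℝ m S (P, x)‖ ≤ C / ‖x‖ ^ k * ‖((K, 0) : (E →L[ℝ] E) × E)‖ ^ 2 := by
    refine norm_iteratedFDeriv_taylor_le contDiff_expQuadExponent m fun y hy => ?_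
    rw [segment_eq_image'] at hy
    obtain ⟨t, ht, rfl⟩ := hy
    have htK : ‖t • K‖ ≤ b / 2 := by
      rw [norm_smul, Real.norm_eq_abs, abs_of_nonneg ht.1]
      exact (mul_le_of_le_one_left (norm_nonneg _) ht.2).trans hK
    have hy : (P, x) + t • ((P, x) + (K, (0 : E)) - (P, x)) = (P + t • K, x) := by
      simp
    simp only [hy]
    rw [le_div_iff₀ hxk, mul_comm]
    refine hC _ _ ((norm_add_le _ _).trans (by linarith)) (inner_apply_perturb hPb htK x)
  have hKn : ‖((K, 0) : (E →L[ℝ] E) × E)‖ = ‖K‖ := by simp [Prod.norm_mk]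
  calc ‖x‖ ^ k * ‖iteratedFDeriv ℝ m (fun y => S (P, y)) x‖
      ≤ ‖x‖ ^ k * (C / ‖x‖ ^ k * ‖K‖ ^ 2) := by
        gcongr
        rw [← hKn]
        exact (norm_iteratedFDeriv_slice_le hS P x).trans hT
    _ = C * ‖K‖ ^ 2 := by field_simp

theorem expQuadDeriv_add {P : E →L[ℝ] E} (hP : P ∈ coerciveOps E) (K K' : E →L[ℝ] E) :
    expQuadDeriv P (K + K') = expQuadDeriv P K + expQuadDeriv P K' := by
  ext x
  simp only [add_apply, expQuadDeriv_apply hP, quadExponent,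
    inner_add_right]
  ring

theorem expQuadDeriv_smul {P : E →L[ℝ] E} (hP : P ∈ coerciveOps E) (c : ℝ) (K : E →L[ℝ] E) :
    expQuadDeriv P (c • K) = c • expQuadDeriv P K := by
  ext x
  simp only [smul_apply, expQuadDeriv_apply hP, quadExponent,
    smul_apply, inner_smul_right, smul_eq_mul]
  ring

/-- Continuity bounds `L` by finitely many Schwartz seminorms, each `O(‖K‖ ^ 2)` on the remainder.
Finite dimension makes the linear candidate derivative continuous. -/
theorem hasFDerivAt_pairing_expQuad [FiniteDimensional ℝ E] {F : Type*} [NormedAddCommGroup F]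
    [NormedSpace ℝ F] (L : 𝓢(E, ℝ) →L[ℝ] F) {P : E →L[ℝ] E} (hP : P ∈ coerciveOps E) :
    ∃ D : (E →L[ℝ] E) →L[ℝ] F, (∀ K, D K = L (expQuadDeriv P K)) ∧
      HasFDerivAt (fun P' => L (expQuadTotal P')) D P := by
  let D₀ : (E →L[ℝ] E) →ₗ[ℝ] F :=
    { toFun := fun K => L (expQuadDeriv P K)
      map_add' := fun K K' => by rw [expQuadDeriv_add hP, map_add]
      map_smul' := fun c K => by rw [expQuadDeriv_smul hP, map_smul, RingHom.id_apply] }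
  refine ⟨LinearMap.toContinuousLinearMap D₀, fun K => rfl, ?_⟩
  rw [hasFDerivAt_iff_isLittleO_nhds_zero]
  obtain ⟨r, hr, hbound⟩ := seminorm_expQuad_taylor_le hP
  obtain ⟨s, C₀, -, hL⟩ := Seminorm.bound_of_continuous (schwartz_withSeminorms ℝ E ℝ)
    ((normSeminorm ℝ F).comp L.toLinearMap) (continuous_norm.comp L.continuous)
  choose C hC using hbound
  have hsum : ∀ K : E →L[ℝ] E, ‖K‖ ≤ r →
      ‖L (expQuadTotal (P + K)) - L (expQuadTotal P) - D₀ K‖ ≤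
        (C₀ * ∑ i ∈ s, |C i.1 i.2|) * ‖K‖ ^ 2 := by
    intro K hK
    have h1 := hL (expQuadTotal (P + K) - expQuadTotal P - expQuadDeriv P K)
    have h2 : (s.sup (schwartzSeminormFamily ℝ E ℝ))
        (expQuadTotal (P + K) - expQuadTotal P - expQuadDeriv P K) ≤
        (∑ i ∈ s, |C i.1 i.2|) * ‖K‖ ^ 2 := by
      refine Seminorm.finset_sup_apply_le (by positivity) fun i hi => ?_
      refine (hC i.1 i.2 K hK).trans ?_
      gcongr
      exact (le_abs_self _).trans
        (Finset.single_le_sum (f := fun i : ℕ × ℕ => |C i.1 i.2|) (fun _ _ => abs_nonneg _) hi)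
    have h3 : ((normSeminorm ℝ F).comp L.toLinearMap)
        (expQuadTotal (P + K) - expQuadTotal P - expQuadDeriv P K) =
        ‖L (expQuadTotal (P + K)) - L (expQuadTotal P) - D₀ K‖ := by
      simp [D₀]
    rw [← h3, mul_assoc]
    exact h1.trans (mul_le_mul_of_nonneg_left h2 C₀.2)
  have hO : (fun K : E →L[ℝ] E => L (expQuadTotal (P + K)) - L (expQuadTotal P) -
      LinearMap.toContinuousLinearMap D₀ K) =O[nhds 0] fun K => ‖K‖ ^ 2 := by
    refine Asymptotics.IsBigO.of_bound (C₀ * ∑ i ∈ s, |C i.1 i.2|) ?_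
    filter_upwards [Metric.closedBall_mem_nhds (0 : E →L[ℝ] E) hr] with K hK
    rw [Real.norm_of_nonneg (by positivity)]
    exact hsum K (by simpa using hK)
  exact hO.trans_isLittleO (Asymptotics.isLittleO_norm_pow_id one_lt_two)

end QuadraticFamily

/-! ### Symmetric matrices and their coordinates -/

section SymmetricMatrices

variable {n : ℕ}

theorem symMatrix_isSymm (A : Idx n → ℝ) : (symMatrix A).IsSymm := by
  ext i j
  rw [Matrix.transpose_apply]
  rcases lt_trichotomy i j with h | rfl | h
  · simp [symMatrix, h.le, not_le.mpr h]
  · rfl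
  · simp [symMatrix, h.le, not_le.mpr h]

theorem symMatrix_add (A B : Idx n → ℝ) : symMatrix (A + B) = symMatrix A + symMatrix B := by
  ext i j
  by_cases h : i ≤ j <;> simp [symMatrix, h]

theorem symMatrix_smul (c : ℝ) (A : Idx n → ℝ) : symMatrix (c • A) = c • symMatrix A := by
  ext i j
  by_cases h : i ≤ j <;> simp [symMatrix, h]

/-- The factor `1/2` for diagonal indices and `1` for all others. -/
def diagFactor (p : Idx n) : ℝ := if p.1.1 = p.1.2 then 1 / 2 else 1

/-- Origin of the powers of `1/2`: on the diagonal the two matrix units coincide and their sum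
counts the entry twice. -/
theorem symMatrix_single (p : Idx n) :
    symMatrix (Pi.single p 1) = diagFactor p •
      (Matrix.single p.1.1 p.1.2 (1 : ℝ) + Matrix.single p.1.2 p.1.1 1) := by
  obtain ⟨⟨i, j⟩, hij⟩ := p
  ext a b
  simp only [symMatrix, Matrix.of_apply, Pi.single_apply, Subtype.mk.injEq, Prod.mk.injEq,
    diagFactor, Matrix.smul_apply, Matrix.add_apply, Matrix.single_apply, smul_eq_mul]
  simp only at hij
  grind

/-- The operator on Euclidean space with matrix `symMatrix A`. -/
def symOp (n : ℕ) :
    (Idx n → ℝ) →L[ℝ] (EuclideanSpace ℝ (Fin n) →L[ℝ] EuclideanSpace ℝ (Fin n)) :=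
  LinearMap.toContinuousLinearMap
    { toFun := fun A => Matrix.toEuclideanCLM (𝕜 := ℝ) (symMatrix A)
      map_add' := fun A B => by rw [symMatrix_add, map_add]
      map_smul' := fun c A => by rw [symMatrix_smul, map_smul, RingHom.id_apply] }

theorem symOp_apply (A : Idx n → ℝ) :
    symOp n A = Matrix.toEuclideanCLM (𝕜 := ℝ) (symMatrix A) := rfl

theorem toEuclideanCLM_inv_mem_coerciveOps {S : Matrix (Fin n) (Fin n) ℝ} (hS : S.PosDef) :
    Matrix.toEuclideanCLM (𝕜 := ℝ) S⁻¹ ∈ coerciveOps (EuclideanSpace ℝ (Fin n)) := by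
  obtain ⟨b, hb, h⟩ := gaussianExponent_le hS
  refine ⟨2 * b, by linarith, fun x => ?_⟩
  rw [Matrix.inner_toEuclideanCLM]
  have := h x
  simp only [gaussianExponent] at this
  linarith

theorem posDef_symMatrix_iff (A : Idx n → ℝ) :
    (symMatrix A).PosDef ↔ symOp n A ∈ coerciveOps (EuclideanSpace ℝ (Fin n)) := by
  constructor
  · intro h
    -- Coercivity is known for inverses of positive definite matrices; apply it to the inverse and
    -- invert back.
    have := toEuclideanCLM_inv_mem_coerciveOps h.inv
    rwa [Matrix.nonsing_inv_nonsing_inv _ (Matrix.isUnit_iff_isUnit_det _ |>.mp h.isUnit)] at this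
  · rintro ⟨b, hb, h⟩
    refine Matrix.PosDef.of_dotProduct_mulVec_pos ?_ fun x hx => ?_
    · exact (Matrix.conjTranspose_eq_transpose_of_trivial _).trans (symMatrix_isSymm A)
    · have := h (WithLp.toLp 2 x)
      rw [symOp_apply, Matrix.inner_toEuclideanCLM] at this
      simp only [star_trivial]
      refine lt_of_lt_of_le ?_ this
      have : WithLp.toLp 2 x ≠ 0 := fun h0 => hx (by simpa using congrArg WithLp.ofLp h0)
      have := norm_pos_iff.mpr this
      positivity

theorem isOpen_posDefCoords : IsOpen (posDefCoords n) := by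
  have : posDefCoords n = symOp n ⁻¹' coerciveOps (EuclideanSpace ℝ (Fin n)) :=
    Set.ext posDef_symMatrix_iff
  rw [this]
  exact isOpen_coerciveOps.preimage (symOp n).continuous

/-- Lets matrix inversion be differentiated as inversion in the algebra of operators. Both inverses
are 0 at non-units, so no invertibility is assumed. -/
theorem ringInverse_symOp (A : Idx n → ℝ) :
    Ring.inverse (symOp n A) = Matrix.toEuclideanCLM (𝕜 := ℝ) (symMatrix A)⁻¹ := by
  rw [symOp_apply, Matrix.nonsing_inv_eq_ringInverse]
  by_cases h : IsUnit (symMatrix A)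
  · obtain ⟨u, hu⟩ := h
    rw [← hu, Ring.inverse_unit]
    exact Ring.inverse_unit (Units.map
      (MonoidHomClass.toMonoidHom (Matrix.toEuclideanCLM (n := Fin n) (𝕜 := ℝ))) u)
  · rw [Ring.inverse_non_unit _ h, map_zero, Ring.inverse_non_unit]
    intro h'
    exact h ((MulEquiv.isUnit_map (Matrix.toEuclideanCLM (n := Fin n) (𝕜 := ℝ))).mp h')

/-- Jacobi's formula: factor out `S`; the linear coefficient of the polynomial `det (1 + X N)` is
the trace of `N`. -/
theorem hasDerivAt_det_add_smul {S : Matrix (Fin n) (Fin n) ℝ} (hS : IsUnit S)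
    (M : Matrix (Fin n) (Fin n) ℝ) :
    HasDerivAt (fun s : ℝ => (S + s • M).det) (S.det * (S⁻¹ * M).trace) 0 := by
  have hp := (Matrix.det (1 + (Polynomial.X : Polynomial ℝ) •
    (S⁻¹ * M).map Polynomial.C)).hasDerivAt 0
  rw [Matrix.derivative_det_one_add_X_smul] at hp
  refine (hp.const_mul S.det).congr_of_eventuallyEq (.of_forall fun s => ?_)
  have h1 : S + s • M = S * (1 + s • (S⁻¹ * M)) := by
    rw [mul_add, mul_one, Matrix.mul_smul, Matrix.mul_nonsing_inv_cancel_left _ _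
      (Matrix.isUnit_iff_isUnit_det _ |>.mp hS)]
  simp only [h1, Matrix.det_mul]
  congr 1
  rw [← Polynomial.coe_evalRingHom, RingHom.map_det]
  congr 1
  ext i j
  by_cases h : i = j <;> simp [h, -Matrix.map_mul, mul_comm s]

theorem differentiable_det_symMatrix : Differentiable ℝ fun A : Idx n → ℝ => (symMatrix A).det := by
  have h (i j : Fin n) : Differentiable ℝ fun A : Idx n → ℝ => symMatrix A i j := by
    by_cases h : i ≤ j <;> simp only [symMatrix, Matrix.of_apply, h, dite_true, dite_false] <;>
      fun_prop
  simp only [Matrix.det_apply]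
  fun_prop

theorem hasFDerivAt_det_symMatrix {A : Idx n → ℝ} (hA : (symMatrix A).PosDef) :
    ∃ D : (Idx n → ℝ) →L[ℝ] ℝ,
      (∀ H, D H = (symMatrix A).det * ((symMatrix A)⁻¹ * symMatrix H).trace) ∧
        HasFDerivAt (fun A : Idx n → ℝ => (symMatrix A).det) D A := by
  have hD := (differentiable_det_symMatrix A).hasFDerivAt
  refine ⟨_, fun H => ?_, hD⟩
  have h1 := hasDerivAt_det_add_smul hA.isUnit (symMatrix H)
  have h2 := hD.hasLineDerivAt H
  simp only [HasLineDerivAt, symMatrix_add, symMatrix_smul] at h2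
  exact h2.unique h1

end SymmetricMatrices

/-! ### The derivative of the Gaussian pairing -/

section Pairing

variable {n : ℕ}

/-- A tempered distribution as a functional on real-valued Schwartz functions. -/
def realPairing (g : 𝓢'(EuclideanSpace ℝ (Fin n), ℂ)) :
    𝓢(EuclideanSpace ℝ (Fin n), ℝ) →L[ℝ] ℂ where
  toFun f := g (f.postcompCLM Complex.ofRealCLM)
  map_add' f f' := by rw [map_add, map_add]
  map_smul' c f := by
    have h : (c • f).postcompCLM Complex.ofRealCLM =
        (c : ℂ) • f.postcompCLM Complex.ofRealCLM := by
      ext x; simp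
    rw [h, map_smul, RingHom.id_apply, Complex.coe_smul]
  cont := (map_continuous g).comp (SchwartzMap.postcompCLM Complex.ofRealCLM).continuous

theorem realPairing_apply (g : 𝓢'(EuclideanSpace ℝ (Fin n), ℂ))
    (f : 𝓢(EuclideanSpace ℝ (Fin n), ℝ)) :
    realPairing g f = g (f.postcompCLM Complex.ofRealCLM) := rfl

/-- The normalizing factor `((2π)^n det S)^(-1/2)`. -/
def normFactor (S : Matrix (Fin n) (Fin n) ℝ) : ℝ :=
  ((2 * Real.pi) ^ n * S.det) ^ (-(1 / 2) : ℝ)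

theorem quadExponent_toEuclideanCLM (M : Matrix (Fin n) (Fin n) ℝ)
    (x : EuclideanSpace ℝ (Fin n)) :
    quadExponent (Matrix.toEuclideanCLM (𝕜 := ℝ) M, x) =
      -(1 / 2) * (x.ofLp ⬝ᵥ M *ᵥ x.ofLp) := by
  rw [quadExponent, Matrix.inner_toEuclideanCLM]

theorem gaussianDensity_eq (S : Matrix (Fin n) (Fin n) ℝ) (x : EuclideanSpace ℝ (Fin n)) :
    gaussianDensity S x =
      normFactor S * Real.exp (quadExponent (Matrix.toEuclideanCLM (𝕜 := ℝ) S⁻¹, x)) := by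
  rw [quadExponent_toEuclideanCLM]; rfl

theorem gaussianPairing_of_posDef (g : 𝓢'(EuclideanSpace ℝ (Fin n), ℂ))
    {S : Matrix (Fin n) (Fin n) ℝ} (hS : S.PosDef) :
    gaussianPairing g S = g (gaussianSchwartz S hS) := dif_pos hS

theorem gaussianPairing_symMatrix (g : 𝓢'(EuclideanSpace ℝ (Fin n), ℂ)) {A : Idx n → ℝ}
    (hA : (symMatrix A).PosDef) :
    gaussianPairing g (symMatrix A) =
      normFactor (symMatrix A) • realPairing g (expQuadTotal (Ring.inverse (symOp n A))) := by
  rw [gaussianPairing_of_posDef g hA, ← map_smul, realPairing_apply]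
  congr 1
  ext x
  rw [ringInverse_symOp, expQuadTotal_of_mem (toEuclideanCLM_inv_mem_coerciveOps hA)]
  simp only [SchwartzMap.postcompCLM_apply, smul_apply, expQuad_apply, smul_eq_mul,
    Complex.ofRealCLM_apply]
  exact congrArg Complex.ofReal (gaussianDensity_eq _ x)

theorem hasFDerivAt_normFactor {A : Idx n → ℝ} (hA : (symMatrix A).PosDef) :
    ∃ D : (Idx n → ℝ) →L[ℝ] ℝ,
      (∀ H, D H = -(1 / 2) * ((symMatrix A)⁻¹ * symMatrix H).trace * normFactor (symMatrix A)) ∧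
        HasFDerivAt (fun A : Idx n → ℝ => normFactor (symMatrix A)) D A := by
  obtain ⟨D, hD, hdet⟩ := hasFDerivAt_det_symMatrix hA
  have hpos : 0 < (2 * Real.pi) ^ n * (symMatrix A).det := by
    have := hA.det_pos
    have := Real.pi_pos
    positivity
  have h := (hdet.const_mul ((2 * Real.pi) ^ n)).rpow_const (p := (-(1 / 2) : ℝ)) (.inl hpos.ne')
  refine ⟨_, fun H => ?_, h⟩
  simp only [smul_apply, smul_eq_mul, hD, normFactor, Real.rpow_sub_one hpos.ne']
  have := hA.det_pos.ne'
  have := Real.pi_pos.ne'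
  field_simp

/-- Product and chain rules, with `-(S⁻¹ H S⁻¹)` the derivative of inversion. The result is gathered
into a single Schwartz function under the pairing, ready for pointwise comparison. -/
theorem hasFDerivAt_gaussianPairing (g : 𝓢'(EuclideanSpace ℝ (Fin n), ℂ)) {A : Idx n → ℝ}
    (hA : (symMatrix A).PosDef) :
    ∃ D : (Idx n → ℝ) →L[ℝ] ℂ,
      (∀ H, D H = realPairing g (normFactor (symMatrix A) •
        (expQuadDeriv (Matrix.toEuclideanCLM (𝕜 := ℝ) (symMatrix A)⁻¹)
          (Matrix.toEuclideanCLM (𝕜 := ℝ) (-((symMatrix A)⁻¹ * symMatrix H * (symMatrix A)⁻¹))) -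
        ((1 / 2) * ((symMatrix A)⁻¹ * symMatrix H).trace) •
          expQuadTotal (Matrix.toEuclideanCLM (𝕜 := ℝ) (symMatrix A)⁻¹)))) ∧
        HasFDerivAt (gaussianPairing g ∘ symMatrix) D A := by
  obtain ⟨Dc, hDc, hc⟩ := hasFDerivAt_normFactor hA
  have hT := toEuclideanCLM_inv_mem_coerciveOps hA
  rw [← ringInverse_symOp] at hT
  obtain ⟨DG, hDG, hG⟩ := hasFDerivAt_pairing_expQuad (realPairing g) hT
  have hunit : IsUnit (symOp n A) :=
    hA.isUnit.map (Matrix.toEuclideanCLM (n := Fin n) (𝕜 := ℝ))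
  obtain ⟨u, hu⟩ := hunit
  have hinv := hasFDerivAt_ringInverse (𝕜 := ℝ) u
  rw [hu] at hinv
  have huinv : (↑u⁻¹ : EuclideanSpace ℝ (Fin n) →L[ℝ] EuclideanSpace ℝ (Fin n)) =
      Matrix.toEuclideanCLM (𝕜 := ℝ) (symMatrix A)⁻¹ := by
    rw [← ringInverse_symOp, ← hu, Ring.inverse_unit]
  have hcomp := hG.comp A (hinv.comp A (symOp n).hasFDerivAt)
  have hprod := hc.smul hcomp
  refine ⟨_, fun H => ?_, hprod.congr_of_eventuallyEq ?_⟩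
  · simp only [Function.comp_apply, add_apply, smul_apply, ContinuousLinearMap.smulRight_apply,
      ContinuousLinearMap.comp_apply, hDG, hDc, ContinuousLinearMap.mulLeftRight_apply, huinv,
      symOp_apply, ← map_mul, ← map_neg]
    rw [← symOp_apply, ringInverse_symOp, map_smul, map_sub, map_smul, smul_sub, smul_smul,
      sub_eq_add_neg, ← neg_smul]
    congr 2
    · rw [mul_neg]
    · ring
  · filter_upwards [isOpen_posDefCoords.mem_nhds hA] with B hB
    exact gaussianPairing_symMatrix g hB

end Pairing

/-! ### Spatial derivatives of the Gaussian density -/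

section Spatial

variable {n : ℕ}

theorem dotProduct_mulVec_comm_of_isSymm {T : Matrix (Fin n) (Fin n) ℝ} (hT : T.IsSymm)
    (v w : Fin n → ℝ) : v ⬝ᵥ T *ᵥ w = w ⬝ᵥ T *ᵥ v := by
  rw [Matrix.dotProduct_mulVec, ← Matrix.mulVec_transpose, hT.eq, dotProduct_comm]

theorem gaussianExponent_add_smul {S : Matrix (Fin n) (Fin n) ℝ} (hS : S⁻¹.IsSymm)
    (x w : EuclideanSpace ℝ (Fin n)) (t : ℝ) :
    gaussianExponent S (x + t • w) = gaussianExponent S x - t * (w.ofLp ⬝ᵥ S⁻¹ *ᵥ x.ofLp) +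
      t ^ 2 * gaussianExponent S w := by
  simp only [gaussianExponent, WithLp.ofLp_add, WithLp.ofLp_smul, Matrix.mulVec_add,
    Matrix.mulVec_smul, dotProduct_add, add_dotProduct, dotProduct_smul, smul_dotProduct,
    smul_eq_mul, dotProduct_mulVec_comm_of_isSymm hS x.ofLp w.ofLp]
  ring

theorem hasLineDerivAt_gaussianDensity {S : Matrix (Fin n) (Fin n) ℝ} (hS : S⁻¹.IsSymm)
    (x w : EuclideanSpace ℝ (Fin n)) :
    HasLineDerivAt ℝ (gaussianDensity S)
      (-(w.ofLp ⬝ᵥ S⁻¹ *ᵥ x.ofLp) * gaussianDensity S x) x w := by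
  have h1 : HasDerivAt (fun t : ℝ => gaussianExponent S (x + t • w))
      (-(w.ofLp ⬝ᵥ S⁻¹ *ᵥ x.ofLp)) 0 := by
    simp only [gaussianExponent_add_smul hS]
    have h := (((hasDerivAt_id (0 : ℝ)).mul_const (w.ofLp ⬝ᵥ S⁻¹ *ᵥ x.ofLp)).const_sub
      (gaussianExponent S x)).add (((hasDerivAt_id (0 : ℝ)).pow 2).mul_const (gaussianExponent S w))
    exact h.congr_deriv (by simp)
  have h2 := h1.exp.const_mul (((2 * Real.pi) ^ n * S.det) ^ (-(1 / 2) : ℝ))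
  simp only [zero_smul, add_zero] at h2
  exact HasDerivAt.congr_deriv h2 (by rw [gaussianDensity]; ring)

theorem lineDerivOp_gaussianSchwartz_apply {S : Matrix (Fin n) (Fin n) ℝ} (hS : S.PosDef)
    (v x : EuclideanSpace ℝ (Fin n)) :
    ∂_{v} (gaussianSchwartz S hS) x =
      ((-(v.ofLp ⬝ᵥ S⁻¹ *ᵥ x.ofLp) * gaussianDensity S x : ℝ) : ℂ) := by
  have hsymm : S⁻¹.IsSymm :=
    (Matrix.conjTranspose_eq_transpose_of_trivial _).symm.trans hS.inv.isHermitian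
  rw [SchwartzMap.lineDerivOp_apply]
  exact HasLineDerivAt.lineDeriv
    (HasDerivAt.ofReal_comp (hasLineDerivAt_gaussianDensity hsymm x v))

theorem lineDerivOp_lineDerivOp_gaussianSchwartz_apply {S : Matrix (Fin n) (Fin n) ℝ}
    (hS : S.PosDef) (v w x : EuclideanSpace ℝ (Fin n)) :
    ∂_{w} (∂_{v} (gaussianSchwartz S hS)) x =
      (((v.ofLp ⬝ᵥ S⁻¹ *ᵥ x.ofLp) * (w.ofLp ⬝ᵥ S⁻¹ *ᵥ x.ofLp) - v.ofLp ⬝ᵥ S⁻¹ *ᵥ w.ofLp) *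
        gaussianDensity S x : ℝ) := by
  have hsymm : S⁻¹.IsSymm :=
    (Matrix.conjTranspose_eq_transpose_of_trivial _).symm.trans hS.inv.isHermitian
  have hfun : ⇑(∂_{v} (gaussianSchwartz S hS) : 𝓢(EuclideanSpace ℝ (Fin n), ℂ)) =
      fun x : EuclideanSpace ℝ (Fin n) => ((-(v.ofLp ⬝ᵥ S⁻¹ *ᵥ x.ofLp) * gaussianDensity S x : ℝ) : ℂ) :=
    funext (lineDerivOp_gaussianSchwartz_apply hS v)
  rw [SchwartzMap.lineDerivOp_apply, hfun]
  have h1 : HasDerivAt (fun t : ℝ => -(v.ofLp ⬝ᵥ S⁻¹ *ᵥ (x + t • w).ofLp))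
      (-(v.ofLp ⬝ᵥ S⁻¹ *ᵥ w.ofLp)) 0 := by
    simp only [WithLp.ofLp_add, WithLp.ofLp_smul, Matrix.mulVec_add, Matrix.mulVec_smul,
      dotProduct_add, dotProduct_smul, smul_eq_mul]
    have h := (((hasDerivAt_id (0 : ℝ)).mul_const (v.ofLp ⬝ᵥ S⁻¹ *ᵥ w.ofLp)).const_add
      (v.ofLp ⬝ᵥ S⁻¹ *ᵥ x.ofLp)).neg
    exact h.congr_deriv (by simp)
  have h2 := HasDerivAt.mul h1 (hasLineDerivAt_gaussianDensity hsymm x w)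
  have h3 : HasLineDerivAt ℝ (fun x : EuclideanSpace ℝ (Fin n) =>
      ((-(v.ofLp ⬝ᵥ S⁻¹ *ᵥ x.ofLp) * gaussianDensity S x : ℝ) : ℂ)) _ x w :=
    HasDerivAt.ofReal_comp h2
  rw [h3.lineDeriv]
  simp only [zero_smul, add_zero]
  congr 1
  ring

/-- Each transfer of a derivative costs a sign; the two signs cancel. -/
theorem lineDeriv_lineDeriv_apply_gaussianSchwartz (g : 𝓢'(EuclideanSpace ℝ (Fin n), ℂ))
    {S : Matrix (Fin n) (Fin n) ℝ} (hS : S.PosDef) (v w : EuclideanSpace ℝ (Fin n)) :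
    (∂_{v} (∂_{w} g)) (gaussianSchwartz S hS) = g (∂_{w} (∂_{v} (gaussianSchwartz S hS))) := by
  simp only [TemperedDistribution.lineDerivOp_apply_apply, LineDeriv.lineDerivOp_neg, neg_neg]

/-- The second order distributional derivative belonging to an index `(i, j)`. -/
def pairDeriv (p : Idx n) (g : 𝓢'(EuclideanSpace ℝ (Fin n), ℂ)) :
    𝓢'(EuclideanSpace ℝ (Fin n), ℂ) :=
  ∂_{EuclideanSpace.single p.1.1 (1 : ℝ)} (∂_{EuclideanSpace.single p.1.2 (1 : ℝ)} g)

theorem trace_mul_symMatrix_single {T : Matrix (Fin n) (Fin n) ℝ} (hT : T.IsSymm) (p : Idx n) :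
    (T * symMatrix (Pi.single p 1)).trace = 2 * diagFactor p * T p.1.1 p.1.2 := by
  rw [symMatrix_single, Matrix.mul_smul, Matrix.trace_smul, mul_add, Matrix.trace_add,
    Matrix.trace_mul_single, Matrix.trace_mul_single, hT.apply]
  simp
  ring

theorem dotProduct_symMatrix_single_mulVec (p : Idx n) (y : Fin n → ℝ) :
    y ⬝ᵥ symMatrix (Pi.single p 1) *ᵥ y = 2 * diagFactor p * (y p.1.1 * y p.1.2) := by
  rw [symMatrix_single, Matrix.smul_mulVec, Matrix.add_mulVec, dotProduct_smul, dotProduct_add,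
    Matrix.single_mulVec, Matrix.single_mulVec]
  simp [dotProduct, Function.update_apply]
  ring

/-- The heat equation. With `T = S⁻¹`, `y = T x` and `E` the coordinate direction, the parameter
derivative is `(1/2) (yᵀ E y - tr (T E)) φ_S`. This is `diagFactor p` times `(y_i y_j - T_ij) φ_S`,
and the latter is `∂_i ∂_j φ_S`. -/
theorem gaussian_parameter_deriv_eq (g : 𝓢'(EuclideanSpace ℝ (Fin n), ℂ)) {A : Idx n → ℝ}
    (hA : (symMatrix A).PosDef) (p : Idx n) :
    realPairing g (normFactor (symMatrix A) •
        (expQuadDeriv (Matrix.toEuclideanCLM (𝕜 := ℝ) (symMatrix A)⁻¹)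
          (Matrix.toEuclideanCLM (𝕜 := ℝ)
            (-((symMatrix A)⁻¹ * symMatrix (Pi.single p 1) * (symMatrix A)⁻¹))) -
        ((1 / 2) * ((symMatrix A)⁻¹ * symMatrix (Pi.single p 1)).trace) •
          expQuadTotal (Matrix.toEuclideanCLM (𝕜 := ℝ) (symMatrix A)⁻¹))) =
      diagFactor p * gaussianPairing (pairDeriv p g) (symMatrix A) := by
  have hsymm : (symMatrix A)⁻¹.IsSymm :=
    (Matrix.conjTranspose_eq_transpose_of_trivial _).symm.trans hA.inv.isHermitian
  have hT := toEuclideanCLM_inv_mem_coerciveOps hA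
  rw [gaussianPairing_of_posDef _ hA, pairDeriv, lineDeriv_lineDeriv_apply_gaussianSchwartz,
    ← smul_eq_mul (diagFactor p : ℂ), ← map_smul, realPairing_apply]
  congr 1
  ext x
  simp only [SchwartzMap.postcompCLM_apply, smul_apply, sub_apply, Complex.ofRealCLM_apply,
    expQuadTotal_of_mem hT, expQuadDeriv_apply hT, expQuad_apply,
    lineDerivOp_lineDerivOp_gaussianSchwartz_apply, trace_mul_symMatrix_single hsymm,
    gaussianDensity_eq, smul_eq_mul, quadExponent_toEuclideanCLM (-_)]
  rw [← Complex.ofReal_mul]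
  congr 1
  set T := (symMatrix A)⁻¹
  set y := T *ᵥ x.ofLp with hy
  have h1 : x.ofLp ⬝ᵥ -(T * symMatrix (Pi.single p 1) * T) *ᵥ x.ofLp =
      -(2 * diagFactor p * (y p.1.1 * y p.1.2)) := by
    rw [← dotProduct_symMatrix_single_mulVec, Matrix.neg_mulVec, dotProduct_neg, Matrix.mul_assoc,
      ← Matrix.mulVec_mulVec, ← Matrix.mulVec_mulVec, ← hy, Matrix.dotProduct_mulVec,
      ← Matrix.mulVec_transpose, hsymm.eq]
  rw [h1]
  simp
  ring

theorem hasFDerivAt_gaussianPairing_single (g : 𝓢'(EuclideanSpace ℝ (Fin n), ℂ)) {A : Idx n → ℝ}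
    (hA : (symMatrix A).PosDef) :
    HasFDerivAt (gaussianPairing g ∘ symMatrix)
      (∑ p : Idx n, (ContinuousLinearMap.proj (R := ℝ) (φ := fun _ : Idx n => ℝ) p).smulRight
        (diagFactor p * gaussianPairing (pairDeriv p g) (symMatrix A) : ℂ)) A := by
  obtain ⟨D, hD, h⟩ := hasFDerivAt_gaussianPairing g hA
  refine h.congr_fderiv (ContinuousLinearMap.ext fun H => ?_)
  rw [show D H = D (∑ p, Pi.single p (H p)) by rw [Finset.univ_sum_single], map_sum]
  simp only [sum_apply, ContinuousLinearMap.smulRight_apply,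
    ContinuousLinearMap.proj_apply]
  refine Finset.sum_congr rfl fun p _ => ?_
  have : Pi.single p (H p) = H p • (Pi.single p 1 : Idx n → ℝ) := by
    rw [← Pi.single_smul, smul_eq_mul, mul_one]
  rw [this, map_smul, hD, gaussian_parameter_deriv_eq g hA]

end Spatial

/-! ### Compositions of powers of commuting operators -/

section MultiOp

variable {ι X : Type*}

theorem foldr_iterate_comp_comm {D : ι → X → X} (hD : ∀ i j, Function.Commute (D i) (D j))
    (β : ι → ℕ) (l : List ι) (i : ι) (k : ℕ) :
    Function.Commute ((D i)^[k]) (l.foldr (fun i T => (D i)^[β i] ∘ T) id) := by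
  induction l with
  | nil => exact Function.Semiconj.id_right
  | cons j l ih => exact ((hD i j).iterate_iterate k (β j)).comp_right ih

theorem foldr_iterate_add {D : ι → X → X} (hD : ∀ i j, Function.Commute (D i) (D j))
    (β γ : ι → ℕ) (l : List ι) :
    l.foldr (fun i T => (D i)^[(β + γ) i] ∘ T) id =
      l.foldr (fun i T => (D i)^[β i] ∘ T) id ∘ l.foldr (fun i T => (D i)^[γ i] ∘ T) id := by
  induction l with
  | nil => rfl
  | cons j l ih =>
    rw [List.foldr_cons, List.foldr_cons, List.foldr_cons, ih, Pi.add_apply,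
      Function.iterate_add]
    have h := (foldr_iterate_comp_comm hD β l j (γ j)).comp_eq
    simp only [Function.comp_assoc]
    rw [← Function.comp_assoc ((D j)^[γ j]), h, Function.comp_assoc]

theorem foldr_iterate_single [DecidableEq ι] (D : ι → X → X) (i : ι) {l : List ι}
    (hl : l.Nodup) :
    l.foldr (fun j T => (D j)^[(Pi.single i 1 : ι → ℕ) j] ∘ T) id = if i ∈ l then D i else id := by
  induction l with
  | nil => rfl
  | cons j l ih =>
    obtain ⟨hj, hl⟩ := List.nodup_cons.mp hl
    rw [List.foldr_cons, ih hl]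
    by_cases h : j = i
    · subst h; simp [hj]
    · simp [h, Ne.symm h]

variable [Fintype ι]

theorem multiOp_zero (D : ι → X → X) : multiOp D 0 = id := by
  unfold multiOp
  generalize (Finset.univ : Finset ι).toList = l
  induction l with
  | nil => rfl
  | cons j l ih => rw [List.foldr_cons, ih]; rfl

theorem multiOp_add {D : ι → X → X} (hD : ∀ i j, Function.Commute (D i) (D j)) (β γ : ι → ℕ) :
    multiOp D (β + γ) = multiOp D β ∘ multiOp D γ :=
  foldr_iterate_add hD β γ _

theorem multiOp_single [DecidableEq ι] (D : ι → X → X) (i : ι) :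
    multiOp D (Pi.single i 1) = D i :=
  (foldr_iterate_single D i (Finset.nodup_toList _)).trans (by simp)

theorem multiOp_smul {D : ι → X → X} (hD : ∀ i j, Function.Commute (D i) (D j)) (k : ℕ)
    (β : ι → ℕ) : multiOp D (k • β) = (multiOp D β)^[k] := by
  induction k with
  | zero => rw [zero_smul, multiOp_zero, Function.iterate_zero]
  | succ k ih => rw [succ_nsmul, multiOp_add hD, ih, Function.iterate_succ]

/-- Commutation makes exponents add. With `v p = e_i + e_j` the resulting exponent is `flatten β`.
-/
theorem multiOp_multiOp {κ : Type*} [Fintype κ] {D : ι → X → X}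
    (hD : ∀ i j, Function.Commute (D i) (D j)) (v : κ → ι → ℕ) (β : κ → ℕ) :
    multiOp (fun p => multiOp D (v p)) β = multiOp D (∑ p, β p • v p) := by
  rw [← Finset.sum_map_toList]
  unfold multiOp
  generalize (Finset.univ : Finset κ).toList = l
  induction l with
  | nil => exact (multiOp_zero D).symm
  | cons j l ih =>
    rw [List.foldr_cons, ih, List.map_cons, List.sum_cons]
    exact (congrArg (· ∘ _) (multiOp_smul hD _ _).symm).trans (multiOp_add hD _ _).symm

end MultiOp

/-! ### Derivatives of all orders of the Gaussian pairing -/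

section Smoothness

variable {n : ℕ}

theorem lineDerivOp_comm_schwartz (v w : EuclideanSpace ℝ (Fin n))
    (f : 𝓢(EuclideanSpace ℝ (Fin n), ℂ)) : ∂_{v} (∂_{w} f) = ∂_{w} (∂_{v} f) := by
  have h (v w : EuclideanSpace ℝ (Fin n)) (x : EuclideanSpace ℝ (Fin n)) :
      (∂_{v} (∂_{w} f) : 𝓢(EuclideanSpace ℝ (Fin n), ℂ)) x = fderiv ℝ (fderiv ℝ f) x v w := by
    have hfun : ⇑(∂_{w} f : 𝓢(EuclideanSpace ℝ (Fin n), ℂ)) = fun y => fderiv ℝ f y w :=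
      funext fun y => SchwartzMap.lineDerivOp_apply_eq_fderiv w f y
    rw [SchwartzMap.lineDerivOp_apply_eq_fderiv, hfun]
    have hd : DifferentiableAt ℝ (fderiv ℝ f) x :=
      ((f.smooth 2).fderiv_right (m := 1) (by norm_num)).differentiable one_ne_zero x
    rw [fderiv_clm_apply hd (differentiableAt_const w)]
    simp
  ext x
  rw [h, h]
  exact ((f.smooth 2).contDiffAt.isSymmSndFDerivAt (by simp)).eq v w

theorem lineDerivOp_comm_tempered (v w : EuclideanSpace ℝ (Fin n))
    (g : 𝓢'(EuclideanSpace ℝ (Fin n), ℂ)) : ∂_{v} (∂_{w} g) = ∂_{w} (∂_{v} g) := by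
  ext f
  simp only [TemperedDistribution.lineDerivOp_apply_apply, LineDeriv.lineDerivOp_neg, neg_neg,
    lineDerivOp_comm_schwartz v w]

theorem multiOp_pairDeriv (β : Idx n → ℕ) (g : 𝓢'(EuclideanSpace ℝ (Fin n), ℂ)) :
    multiOp pairDeriv β g = distribDeriv (flatten β) g := by
  have hcomm (i j : Fin n) : Function.Commute
      (fun T : 𝓢'(EuclideanSpace ℝ (Fin n), ℂ) => ∂_{EuclideanSpace.single i (1 : ℝ)} T)
      (fun T => ∂_{EuclideanSpace.single j (1 : ℝ)} T) :=
    fun T => lineDerivOp_comm_tempered _ _ T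
  have hpair : (pairDeriv : Idx n → _) = fun p => multiOp
      (fun i (T : 𝓢'(EuclideanSpace ℝ (Fin n), ℂ)) => ∂_{EuclideanSpace.single i (1 : ℝ)} T)
      (Pi.single p.1.1 1 + Pi.single p.1.2 1) := by
    funext p
    rw [multiOp_add hcomm, multiOp_single, multiOp_single]
    rfl
  rw [hpair, multiOp_multiOp hcomm]
  rfl

/-- The derivative is a finite sum of pairings with `pairDeriv p g`, so the induction has to range
over all `g`. -/
theorem contDiffOn_gaussianPairing_nat (k : ℕ) (g : 𝓢'(EuclideanSpace ℝ (Fin n), ℂ)) :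
    ContDiffOn ℝ k (gaussianPairing g ∘ symMatrix) (posDefCoords n) := by
  induction k generalizing g with
  | zero =>
    exact contDiffOn_zero.mpr fun A hA =>
      (hasFDerivAt_gaussianPairing_single g hA).continuousAt.continuousWithinAt
  | succ k ih =>
    push_cast
    refine (contDiffOn_succ_iff_fderiv_of_isOpen isOpen_posDefCoords).mpr
      ⟨fun A hA => (hasFDerivAt_gaussianPairing_single g hA).differentiableAt.differentiableWithinAt,
        by simp, ?_⟩
    refine ContDiffOn.congr ?_ fun A hA => (hasFDerivAt_gaussianPairing_single g hA).fderiv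
    refine ContDiffOn.sum fun p _ => ?_
    exact (ContinuousLinearMap.smulRightL ℝ (Idx n → ℝ) ℂ
      (ContinuousLinearMap.proj p)).contDiff.comp_contDiffOn
        (contDiffOn_const.mul (ih (pairDeriv p g)))

/-- Agreement on the open set `posDefCoords n` suffices, since derivatives are local. The conclusion
has the form of the hypothesis, so the step can be iterated. -/
theorem lineDeriv_gaussianPairing {g : 𝓢'(EuclideanSpace ℝ (Fin n), ℂ)} {G : (Idx n → ℝ) → ℂ}
    {c : ℂ} (hG : ∀ A ∈ posDefCoords n, G A = c * gaussianPairing g (symMatrix A)) (p : Idx n) :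
    ∀ A ∈ posDefCoords n, lineDeriv ℝ G A (Pi.single p 1) =
      diagFactor p * c * gaussianPairing (pairDeriv p g) (symMatrix A) := by
  intro A hA
  have h := ((hasFDerivAt_gaussianPairing_single g hA).const_mul c).congr_of_eventuallyEq
    (f₁ := G) (by filter_upwards [isOpen_posDefCoords.mem_nhds hA] with B hB using hG B hB)
  rw [(h.hasLineDerivAt (Pi.single p 1)).lineDeriv, smul_apply, sum_apply,
    Finset.sum_eq_single p (fun q _ hq => by simp [hq]) (by simp)]
  simp
  ring

theorem iterate_lineDeriv_gaussianPairing (p : Idx n) (k : ℕ)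
    {g : 𝓢'(EuclideanSpace ℝ (Fin n), ℂ)} {G : (Idx n → ℝ) → ℂ} {c : ℂ}
    (hG : ∀ A ∈ posDefCoords n, G A = c * gaussianPairing g (symMatrix A)) :
    ∀ A ∈ posDefCoords n,
      (fun (G : (Idx n → ℝ) → ℂ) x => lineDeriv ℝ G x (Pi.single p 1))^[k] G A =
        diagFactor p ^ k * c * gaussianPairing ((pairDeriv p)^[k] g) (symMatrix A) := by
  induction k with
  | zero => simpa using hG
  | succ k ih =>
    rw [Function.iterate_succ_apply', Function.iterate_succ_apply']
    intro A hA
    rw [lineDeriv_gaussianPairing ih p A hA]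
    ring

/-- Both sides compose their operators along the same list, so no commutation is needed here. -/
theorem partialDeriv_gaussianPairing (β : Idx n → ℕ) (g : 𝓢'(EuclideanSpace ℝ (Fin n), ℂ)) :
    ∀ A ∈ posDefCoords n, partialDeriv β (gaussianPairing g ∘ symMatrix) A =
      (∏ p, (diagFactor p : ℂ) ^ β p) *
        gaussianPairing (multiOp pairDeriv β g) (symMatrix A) := by
  rw [← Finset.prod_map_toList]
  unfold partialDeriv multiOp
  generalize (Finset.univ : Finset (Idx n)).toList = l
  induction l with
  | nil => simp
  | cons p l ih =>
    simp only [List.foldr_cons, Function.comp_apply, List.map_cons, List.prod_cons]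
    exact iterate_lineDeriv_gaussianPairing p (β p) ih

/-- Off-diagonal factors are 1; the rest are reindexed by `i ↦ (i, i)`. -/
theorem prod_diagFactor_pow (β : Idx n → ℕ) :
    ∏ p, (diagFactor p : ℂ) ^ β p = (1 / 2 : ℂ) ^ diagDegree β := by
  rw [diagDegree, ← Finset.prod_pow_eq_pow_sum]
  refine (Finset.prod_of_injOn (fun i : Fin n => (⟨(i, i), le_rfl⟩ : Idx n)) ?_ ?_ ?_ ?_).symm
  · intro i _ j _ h
    simpa using h
  · simp
  · rintro ⟨⟨i, j⟩, hij⟩ _ h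
    have : i ≠ j := by
      rintro rfl
      simp at h
    simp [diagFactor, this]
  · intro i _
    simp [diagFactor]

end Smoothness

end Price

end

theorem theorem1 (n : ℕ) (g : 𝓢'(EuclideanSpace ℝ (Fin n), ℂ)) :
    IsOpen (Price.posDefCoords n) ∧
    ContDiffOn ℝ ∞ (Price.gaussianPairing g ∘ Price.symMatrix) (Price.posDefCoords n) ∧
    ∀ (β : Price.Idx n → ℕ) (A : Price.Idx n → ℝ) (hA : (Price.symMatrix A).PosDef),
      Price.partialDeriv β (Price.gaussianPairing g ∘ Price.symMatrix) A =
        (1 / 2 : ℂ) ^ Price.diagDegree β *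
          Price.distribDeriv (Price.flatten β) g
            (Price.gaussianSchwartz (Price.symMatrix A) hA) := by
  refine ⟨Price.isOpen_posDefCoords,
    contDiffOn_infty.mpr fun k => Price.contDiffOn_gaussianPairing_nat k g, fun β A hA => ?_⟩
  rw [Price.partialDeriv_gaussianPairing β g A hA, Price.prod_diagFactor_pow,
    Price.multiOp_pairDeriv, Price.gaussianPairing_of_posDef _ hA]
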